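/- Let $K \ge 1$, let $\Delta_{K-1} = \{w \in \mathbf{R}^K : w \ge 0,\ w'\mathbf{1} = 1\}$, and let $B_2$ be a $K \times (K-1)$ matrix whose columns are orthonormal and orthogonal to the vector $\mathbf{1}$ of ones. Let $\Omega$ be a symmetric positive definite $(K-1)\times(K-1)$ matrix, put $\langle x,y\rangle_\Omega = x'\Omega^{-1}y$ and $\|x\|_\Omega = \sqrt{x'\Omega^{-1}x}$, and for a nonempty closed convex set $C \subset \mathbf{R}^{K-1}$ let $\Pi_\Omega(y \mid C)$ be the point of $C$ nearest to $y$ in $\|\cdot\|_\Omega$. For $w \in \Delta_{K-1}$ let $$\Lambda(w) = \{B_2'\lambda : \lambda \in \mathbf{R}^K,\ \lambda \ge 0,\ w'\lambda = 0\}, \qquad \Lambda^\circ(w) = \{x \in \mathbf{R}^{K-1} : \langle x, v\rangle_\Omega \le 0 \text{ for all } v \in \Lambda(w)\}.$$ For $x \in \mathbf{R}^K$ let $J_0[x] = \{j : x_j = 0\}$, and let $G^{-1}(\cdot\,;k)$ be the quantile function of the $\chi^2$ distribution with $k$ degrees of freedom. For $\alpha \in (0,1)$ and $y \in \mathbf{R}^{K-1}$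 define $$c_{1-\alpha,\Omega}(y;w) = G^{-1}\bigl(1-\alpha;\ \max\{K-1-|J_0[B_2\Omega^{-1}\Pi_\Omega(y \mid \Lambda^\circ(w))]|,\ 1\}\bigr),$$ $$q_{1-\alpha,\Omega}(y;w) = \sum_{F} 1\{\Pi_\Omega(y \mid \Lambda^\circ(w)) \in \mathrm{ri}(F)\}\; G^{-1}\bigl(1-\alpha;\ \max\{\mathrm{rk}(P_F), 1\}\bigr),$$ where $F$ runs over the nonempty faces of $\Lambda^\circ(w)$, $\mathrm{ri}(F)$ is the relative interior of $F$, and $P_F$ is the projection onto the linear span of $F$. Suppose that $Y \sim N(\mu,\Omega)$ in $\mathbf{R}^{K-1}$. Then for every $\alpha \in (0,1)$ and every $w \in \Delta_{K-1}$: (a) if $\mu \in \Lambda(w)$, then $$P\bigl\{\|Y - \Pi_\Omega(Y \mid \Lambda(w))\|_\Omega^2 > c_{1-\alpha,\Omega}(Y;w)\bigr\} \le \alpha;$$ (b) for every $\mu \in \mathbf{R}^{K-1}$, $q_{1-\alpha,\Omega}(Y;w) = c_{1-\alpha,\Omega}(Y;w)$ almost surely. -/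

import Mathlib

open MeasureTheory ProbabilityTheory
open scoped Matrix

noncomputable section

namespace SimplexInference

/-- The inner product `⟨x, y⟩_Ω = x' Ω⁻¹ y` on `ℝⁿ`. -/
def innerΩ {n : ℕ} (Ω : Matrix (Fin n) (Fin n) ℝ) (x y : EuclideanSpace ℝ (Fin n)) : ℝ :=
  x.ofLp ⬝ᵥ (Ω⁻¹ *ᵥ y.ofLp)

/-- The norm `‖x‖_Ω = √(x' Ω⁻¹ x)`. -/
def normΩ {n : ℕ} (Ω : Matrix (Fin n) (Fin n) ℝ) (x : EuclideanSpace ℝ (Fin n)) : ℝ :=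
  √(innerΩ Ω x x)

/-- `x` is a point of `C` that is nearest to `y` in the norm `‖·‖_Ω`. -/
def IsProjΩ {n : ℕ} (Ω : Matrix (Fin n) (Fin n) ℝ) (C : Set (EuclideanSpace ℝ (Fin n)))
    (y x : EuclideanSpace ℝ (Fin n)) : Prop :=
  x ∈ C ∧ ∀ z ∈ C, normΩ Ω (y - x) ≤ normΩ Ω (y - z)

/-- The projection `Π_Ω(y | C)` along `‖·‖_Ω`. For positive definite `Ω` and nonempty, closed,
convex `C` there is exactly one point satisfying `IsProjΩ`, and this is it. -/
def projΩ {n : ℕ} (Ω : Matrix (Fin n) (Fin n) ℝ) (C : Set (EuclideanSpace ℝ (Fin n)))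
    (y : EuclideanSpace ℝ (Fin n)) : EuclideanSpace ℝ (Fin n) :=
  Classical.epsilon (IsProjΩ Ω C y)

/-- The columns of the `K × (K-1)` matrix `B₂` are orthonormal and orthogonal to the vector of
ones; equivalently `[𝟏/√K, B₂]` is an orthogonal matrix. -/
def IsContrastBasis {K : ℕ} (B₂ : Matrix (Fin K) (Fin (K - 1)) ℝ) : Prop :=
  B₂ᵀ * B₂ = 1 ∧ ∀ i, ∑ j, B₂ j i = 0

/-- The polyhedral cone `Λ(w) = {B₂' l : l ≥ 0, w' l = 0}`. -/
def coneΛ {K : ℕ} (B₂ : Matrix (Fin K) (Fin (K - 1)) ℝ) (w : Fin K → ℝ) :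
    Set (EuclideanSpace ℝ (Fin (K - 1))) :=
  {x | ∃ l : Fin K → ℝ, 0 ≤ l ∧ w ⬝ᵥ l = 0 ∧ x.ofLp = B₂ᵀ *ᵥ l}

/-- The polar cone of `C` with respect to `⟨·,·⟩_Ω`. -/
def polarΩ {n : ℕ} (Ω : Matrix (Fin n) (Fin n) ℝ) (C : Set (EuclideanSpace ℝ (Fin n))) :
    Set (EuclideanSpace ℝ (Fin n)) :=
  {x | ∀ v ∈ C, innerΩ Ω x v ≤ 0}

/-- `J₀[x]`, the set of indices of the zero entries of `x`. -/
def zeroSet {K : ℕ} (x : Fin K → ℝ) : Set (Fin K) :=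
  {j | x j = 0}

/-- The `χ²` distribution with `k` degrees of freedom: the law of the sum of the squares of `k`
independent standard normal variables. -/
def chiSquared (k : ℕ) : Measure ℝ :=
  (Measure.pi fun _ : Fin k => gaussianReal 0 1).map fun z => ∑ i, z i ^ 2

/-- The quantile `G⁻¹(p; k)` of the `χ²` distribution with `k` degrees of freedom. -/
def chiSquaredQuantile (p : ℝ) (k : ℕ) : ℝ :=
  sInf {x : ℝ | p ≤ cdf (chiSquared k) x}

/-- The vector `π°_Ω(y; w) = B₂ Ω⁻¹ Π_Ω(y | Λ°(w))` in `ℝᴷ`. -/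
def polarScore {K : ℕ} (B₂ : Matrix (Fin K) (Fin (K - 1)) ℝ)
    (Ω : Matrix (Fin (K - 1)) (Fin (K - 1)) ℝ) (w : Fin K → ℝ)
    (y : EuclideanSpace ℝ (Fin (K - 1))) : Fin K → ℝ :=
  (B₂ * Ω⁻¹) *ᵥ (projΩ Ω (polarΩ Ω (coneΛ B₂ w)) y).ofLp

/-- The critical value `c_{1-α,Ω}(y; w)`. The truncated subtraction is harmless, because of the
maximum with `1`. -/
def critValue {K : ℕ} (B₂ : Matrix (Fin K) (Fin (K - 1)) ℝ)
    (Ω : Matrix (Fin (K - 1)) (Fin (K - 1)) ℝ) (α : ℝ) (w : Fin K → ℝ)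
    (y : EuclideanSpace ℝ (Fin (K - 1))) : ℝ :=
  chiSquaredQuantile (1 - α) (max (K - 1 - (zeroSet (polarScore B₂ Ω w y)).ncard) 1)

/-- `F` is a (nonempty) face of the convex set `C`. -/
def IsFaceOf {n : ℕ} (C F : Set (EuclideanSpace ℝ (Fin n))) : Prop :=
  F.Nonempty ∧ Convex ℝ F ∧ IsExtreme ℝ C F

open scoped Classical in
/-- The face-indexed critical value
`q_{1-α,Ω}(y; w) = ∑_F 1{Π_Ω(y | Λ°(w)) ∈ ri F} G⁻¹(1 - α; max {rk P_F, 1})`,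
where `F` runs over the faces of the polar cone `Λ°(w)` and `P_F` is the projection onto the linear
span of `F`, so that `rk P_F` is the dimension of that span. -/
def faceCritValue {K : ℕ} (B₂ : Matrix (Fin K) (Fin (K - 1)) ℝ)
    (Ω : Matrix (Fin (K - 1)) (Fin (K - 1)) ℝ) (α : ℝ) (w : Fin K → ℝ)
    (y : EuclideanSpace ℝ (Fin (K - 1))) : ℝ :=
  ∑ᶠ F ∈ {F | IsFaceOf (polarΩ Ω (coneΛ B₂ w)) F},
    if projΩ Ω (polarΩ Ω (coneΛ B₂ w)) y ∈ intrinsicInterior ℝ F then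
      chiSquaredQuantile (1 - α) (max (Module.finrank ℝ (Submodule.span ℝ F)) 1)
    else 0

end SimplexInference

end

/-! Whitening by `R = Ω^(1/2)` turns `Y` into a vector `x` with law `N(m, I)`, the cone `Λ(w)` into
`posCone b J` and its polar into `negDual b J`, where `J` is the zero set of `w`. With the Moreau
decomposition `x = u + (x - u)`, the statistic equals `‖u‖²`.

Partition the space by the set `A ⊆ J` of constraints active at `u`. On the cell of `A`, `u` is the
orthogonal projection onto `L = orthSpace b A`, and the cell is the product of a cone in `L` and a
cone in `Lᗮ`. Any proper subfamily of the generators is independent, because the kernel of `B₂'` is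
spanned by the ones; so `dim L = K - 1 - |A|`. The two components are independent. A mean in
`posCone b J` has nonpositive inner product with the cone in `L`, so along each ray the likelihood
ratio against the centred Gaussian decreases with the radius. Conditionally on the cell, `‖u‖²` is
therefore dominated by `χ²` with `dim L` degrees of freedom (`gaussian_cone_tail_le`,
`gaussian_product_tail_le`). Summing over cells gives (a) for the critical value `activeCrit`
(`gaussian_isMoreau_tail_le`).

It remains to compare critical values. The projection lies in the relative interior of exactly one
face, whose span has dimension `K - 1 - |A|`, so `q` always equals `activeCrit`. The value `c` also
counts zeros not recorded in `A`. Such a zero either has probability zero or is forced by the span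
of the active generators; the latter needs `|A| = K - 1`, where the maximum with `1` hides it. Hence
`c` equals `activeCrit` almost surely, which gives (b) and completes (a). -/

noncomputable section

namespace SimplexInference

/-! ### Gaussian tails on cones, and chi-squared quantiles. -/

section Gaussian

open Module Measure
open scoped RealInnerProductSpace ENNReal

/-- The density of the standard Gaussian measure in dimension `n`, as a function of the norm. -/
def radialDensity (n : ℕ) (r : ℝ) : ℝ :=
  (2 * Real.pi) ^ (-(n : ℝ) / 2) * Real.exp (-(r ^ 2) / 2)

lemma radialDensity_nonneg (n : ℕ) (r : ℝ) : 0 ≤ radialDensity n r := by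
  unfold radialDensity; positivity

@[fun_prop]
lemma measurable_radialDensity (n : ℕ) : Measurable (radialDensity n) := by
  unfold radialDensity; fun_prop

lemma radialDensity_norm_smul_sub {V : Type*} [NormedAddCommGroup V] [InnerProductSpace ℝ V]
    (n : ℕ) (r : ℝ) {u : V} (hu : ‖u‖ = 1) (m : V) :
    radialDensity n ‖r • u - m‖
      = radialDensity n r * Real.exp (r * ⟪u, m⟫ - ‖m‖ ^ 2 / 2) := by
  rw [radialDensity, radialDensity, mul_assoc, ← Real.exp_add, norm_sub_sq_real, norm_smul, hu,
    real_inner_smul_left]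
  congr 2
  simp
  ring

variable {V : Type*} [NormedAddCommGroup V] [InnerProductSpace ℝ V] [FiniteDimensional ℝ V]
  [MeasurableSpace V] [BorelSpace V]

variable (V) in
lemma integrable_radialDensity_norm : Integrable (fun x : V => radialDensity (finrank ℝ V) ‖x‖) := by
  have h := (GaussianFourier.integrable_cexp_neg_mul_sq_norm_add (V := V) (b := 1 / 2)
    (by norm_num) 0 0).norm.const_mul ((2 * Real.pi) ^ (-(finrank ℝ V : ℝ) / 2))
  refine h.congr (.of_forall fun x => ?_)
  simp only [radialDensity, Complex.norm_exp]
  congr 2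
  simp [← Complex.ofReal_pow]
  ring

/-- The standard Gaussian measure has the usual density. -/
lemma stdGaussian_eq_withDensity :
    stdGaussian V = volume.withDensity fun x => ENNReal.ofReal (radialDensity (finrank ℝ V) ‖x‖) := by
  have hfin : IsFiniteMeasure
      (volume.withDensity fun x : V => ENNReal.ofReal (radialDensity (finrank ℝ V) ‖x‖)) :=
    isFiniteMeasure_withDensity_ofReal (integrable_radialDensity_norm V).2
  refine Measure.ext_of_charFun (funext fun t => ?_)
  rw [charFun_stdGaussian, charFun_apply,
    integral_withDensity_eq_integral_toReal_smul (by fun_prop) (by simp)]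
  have hb : (0 : ℝ) < (1 / 2 : ℂ).re := by norm_num
  -- The coefficient `Complex.I` turns the Gaussian integral into the characteristic function at
  -- `t`.
  have h := GaussianFourier.integral_cexp_neg_mul_sq_norm_add hb Complex.I t
  have hpi : (0 : ℝ) < 2 * Real.pi := by positivity
  calc Complex.exp (-‖t‖ ^ 2 / 2)
      = ((2 * Real.pi) ^ (-(finrank ℝ V : ℝ) / 2) : ℝ) *
          ((Real.pi / (1 / 2 : ℂ)) ^ (finrank ℝ V / 2 : ℂ) *
            Complex.exp (Complex.I ^ 2 * ‖t‖ ^ 2 / (4 * (1 / 2 : ℂ)))) := by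
        have h1 : (Real.pi / (1 / 2 : ℂ)) ^ (finrank ℝ V / 2 : ℂ)
            = (((2 * Real.pi) ^ ((finrank ℝ V : ℝ) / 2) : ℝ) : ℂ) := by
          rw [Complex.ofReal_cpow hpi.le]
          push_cast
          congr 1
          ring
        rw [h1, ← mul_assoc, ← Complex.ofReal_mul, ← Real.rpow_add hpi,
          neg_div (2 : ℝ), neg_add_cancel]
        simp only [Real.rpow_zero, Complex.ofReal_one, one_mul, Complex.I_sq]
        congr 1
        ring
    _ = _ := by
        rw [← h, ← integral_const_mul]
        congr 1 with x
        rw [ENNReal.toReal_ofReal (radialDensity_nonneg (finrank ℝ V) _), radialDensity, Complex.real_smul,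
          Complex.ofReal_mul, mul_assoc, Complex.ofReal_exp, ← Complex.exp_add, real_inner_comm]
        congr 2
        push_cast
        ring

/-- Integration in polar coordinates. -/
lemma lintegral_eq_lintegral_toSphere [Nontrivial V] {f : V → ℝ≥0∞} (hf : Measurable f) :
    ∫⁻ x, f x = ∫⁻ u, ∫⁻ r, f ((r : ℝ) • (u : V)) ∂(volumeIoiPow (finrank ℝ V - 1))
      ∂(volume : Measure V).toSphere := by
  have h := (volume : Measure V).measurePreserving_homeomorphUnitSphereProd
  have hne : ∫⁻ x, f x = ∫⁻ x in {0}ᶜ, f x := by rw [restrict_compl_singleton]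
  rw [← lintegral_prod (fun p : Metric.sphere (0 : V) 1 × Set.Ioi (0 : ℝ) =>
      f ((p.2 : ℝ) • (p.1 : V))) (by fun_prop), ← h.lintegral_comp (by fun_prop),
    hne, ← lintegral_subtype_comap (measurableSet_singleton _).compl]
  refine lintegral_congr fun x => ?_
  congr 1
  have hx : ‖(x : V)‖ ≠ 0 := norm_ne_zero_iff.2 x.2
  simp [smul_smul, hx]

/-- An antitone weight puts no more than its share on an upper tail. -/
lemma setLIntegral_le_mul_lintegral_of_antitone {R : Type*} [MeasurableSpace R] {ρ : Measure R}
    [IsFiniteMeasure ρ] {B : Set R} (hB : MeasurableSet B) {f : R → ℝ≥0∞} {M a : ℝ≥0∞}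
    (hfB : ∀ r ∈ B, f r ≤ M) (hfB' : ∀ r ∉ B, M ≤ f r) (ha : a ≤ 1)
    (hρ : ρ B ≤ a * ρ Set.univ) : ∫⁻ r in B, f r ∂ρ ≤ a * ∫⁻ r, f r ∂ρ := by
  have ha' : a ≠ ∞ := ne_top_of_le_ne_top ENNReal.one_ne_top ha
  have h1 : ∫⁻ r in B, f r ∂ρ ≤ M * ρ B := by
    rw [← setLIntegral_const]
    exact setLIntegral_mono_ae' hB (.of_forall hfB)
  have h2 : M * ρ Bᶜ ≤ ∫⁻ r in Bᶜ, f r ∂ρ := by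
    rw [← setLIntegral_const]
    exact setLIntegral_mono_ae' hB.compl (.of_forall hfB')
  have h3 : (1 - a) * ρ B ≤ a * ρ Bᶜ := by
    rw [← measure_add_measure_compl hB, mul_add] at hρ
    rw [ENNReal.sub_mul (by simp [measure_ne_top]), one_mul]
    exact tsub_le_iff_left.2 hρ
  -- Keep the share `a` of the integral over `B`; the share `1 - a` is bounded through the level `M`
  -- by `a` times the integral over `Bᶜ`.
  calc ∫⁻ r in B, f r ∂ρ
      = a * ∫⁻ r in B, f r ∂ρ + (1 - a) * ∫⁻ r in B, f r ∂ρ := by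
        rw [← add_mul, add_tsub_cancel_of_le ha, one_mul]
    _ ≤ a * ∫⁻ r in B, f r ∂ρ + (1 - a) * (M * ρ B) := by gcongr
    _ = a * ∫⁻ r in B, f r ∂ρ + M * ((1 - a) * ρ B) := by ring
    _ ≤ a * ∫⁻ r in B, f r ∂ρ + M * (a * ρ Bᶜ) := by gcongr
    _ = a * ∫⁻ r in B, f r ∂ρ + a * (M * ρ Bᶜ) := by ring
    _ ≤ a * ∫⁻ r in B, f r ∂ρ + a * ∫⁻ r in Bᶜ, f r ∂ρ := by gcongr
    _ = a * ∫⁻ r, f r ∂ρ := by rw [← mul_add, lintegral_add_compl _ hB]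

lemma map_const_add_stdGaussian_apply (m : V) {S : Set V} (hS : MeasurableSet S) :
    (stdGaussian V).map (fun x => m + x) S
      = ∫⁻ x, S.indicator (fun x => ENNReal.ofReal (radialDensity (finrank ℝ V) ‖x - m‖)) x := by
  rw [Measure.map_apply (by fun_prop) hS, stdGaussian_eq_withDensity,
    withDensity_apply _ ((measurable_const_add m) hS),
    ← lintegral_indicator ((measurable_const_add m) hS),
    ← lintegral_add_left_eq_self (fun x => S.indicator _ x) m]
  refine lintegral_congr fun x => ?_
  simp only [Set.indicator, add_sub_cancel_left]
  rfl

/-- If a Gaussian vector with identity covariance has a mean in the polar of a cone `C`, then, given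
that it falls into `C`, its norm is stochastically dominated by that of a standard Gaussian. -/
lemma gaussian_cone_tail_le [Nontrivial V] {C : Set V} (hC : MeasurableSet C)
    (hsmul : ∀ x ∈ C, ∀ r : ℝ, 0 < r → r • x ∈ C) {m : V} (hm : ∀ x ∈ C, ⟪x, m⟫ ≤ 0)
    {c : ℝ} {a : ℝ≥0∞} (ha : a ≤ 1) (hc : stdGaussian V {x | c < ‖x‖ ^ 2} ≤ a) :
    (stdGaussian V).map (fun x => m + x) (C ∩ {x | c < ‖x‖ ^ 2})
      ≤ a * (stdGaussian V).map (fun x => m + x) C := by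
  set n := finrank ℝ V
  set σ := (volume : Measure V).toSphere
  set ρ := (volumeIoiPow (n - 1)).withDensity fun r => ENNReal.ofReal (radialDensity n r)
  have hmeas : Measurable fun r : Set.Ioi (0 : ℝ) => ENNReal.ofReal (radialDensity n r) := by
    fun_prop
  set B : Set (Set.Ioi (0 : ℝ)) := {r | c < (r : ℝ) ^ 2}
  have hB : MeasurableSet B := measurableSet_lt (by fun_prop) (by fun_prop)
  have hT : MeasurableSet {x : V | c < ‖x‖ ^ 2} := measurableSet_lt (by fun_prop) (by fun_prop)
  -- On a ray the density is the centred one, absorbed into `ρ`, times an exponential tilt. The case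
  -- `m = 0` computes the masses of `ρ`.
  have hpolar : ∀ m : V, ∀ S : Set V, MeasurableSet S → (stdGaussian V).map (fun x => m + x) S
      = ∫⁻ u, ∫⁻ r in {r : Set.Ioi (0 : ℝ) | (r : ℝ) • (u : V) ∈ S},
          ENNReal.ofReal (Real.exp (r * ⟪(u : V), m⟫ - ‖m‖ ^ 2 / 2)) ∂ρ ∂σ := by
    intro m S hS
    rw [map_const_add_stdGaussian_apply m hS, lintegral_eq_lintegral_toSphere
      (Measurable.indicator (by fun_prop) hS)]
    refine lintegral_congr fun u => ?_
    have hSu : MeasurableSet {r : Set.Ioi (0 : ℝ) | (r : ℝ) • (u : V) ∈ S} :=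
      (show Measurable fun r : Set.Ioi (0 : ℝ) => (r : ℝ) • (u : V) by fun_prop) hS
    rw [restrict_withDensity hSu, lintegral_withDensity_eq_lintegral_mul _ hmeas (by fun_prop),
      ← lintegral_indicator hSu]
    refine lintegral_congr fun r => ?_
    by_cases hr : (r : ℝ) • (u : V) ∈ S
    · rw [Set.indicator_of_mem hr, Set.indicator_of_mem (by exact hr),
        radialDensity_norm_smul_sub _ _ (by simp),
        ENNReal.ofReal_mul (radialDensity_nonneg _ _), Pi.mul_apply]
    · rw [Set.indicator_of_notMem hr, Set.indicator_of_notMem (by exact hr)]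
  have hnorm : ∀ (u : Metric.sphere (0 : V) 1) (r : Set.Ioi (0 : ℝ)), ‖(r : ℝ) • (u : V)‖ = r :=
    fun u r => by simp [norm_smul, abs_of_pos r.2.out]
  -- Neither `ρ` nor `σ` is normalised; only the product of their masses is one.
  have huniv : ρ Set.univ * σ Set.univ = 1 := by
    have := hpolar 0 Set.univ .univ
    simpa using this.symm
  have hρB : ρ B * σ Set.univ ≤ a := by
    have := hpolar 0 _ hT
    simp only [zero_add, Measure.map_id', Set.mem_ofPred_eq, hnorm] at this
    rw [this] at hc
    simpa [B] using hc
  have hρfin : IsFiniteMeasure ρ := by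
    refine ⟨lt_top_iff_ne_top.2 fun h => ?_⟩
    rw [h, ENNReal.top_mul (by simpa only [ne_eq, measure_univ_eq_zero] using toSphere_ne_zero _)] at huniv
    exact ENNReal.top_ne_one huniv
  have hρ : ρ B ≤ a * ρ Set.univ := by
    calc ρ B = ρ B * σ Set.univ * ρ Set.univ := by rw [mul_assoc, mul_comm (σ _), huniv, mul_one]
      _ ≤ a * ρ Set.univ := by gcongr
  rw [hpolar m _ (hC.inter hT), hpolar m _ hC, ← lintegral_const_mul' _ _
    (ne_top_of_le_ne_top ENNReal.one_ne_top ha)]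
  refine lintegral_mono fun u => ?_
  by_cases hu : (u : V) ∈ C
  · have h1 : {r : Set.Ioi (0 : ℝ) | (r : ℝ) • (u : V) ∈ C} = Set.univ :=
      Set.eq_univ_of_forall fun r => hsmul _ hu _ r.2
    have h2 : {r : Set.Ioi (0 : ℝ) | (r : ℝ) • (u : V) ∈ C ∩ {x | c < ‖x‖ ^ 2}} = B := by
      ext r
      simp only [Set.mem_ofPred_eq, Set.mem_inter_iff, hnorm, B, hsmul _ hu _ r.2, true_and]
    rw [h1, h2, Measure.restrict_univ]
    refine setLIntegral_le_mul_lintegral_of_antitone hB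
      -- `M` is the tilt at the threshold radius. For `c < 0` the convention `√c = 0` is harmless,
      -- since `B` is then everything.
      (M := ENNReal.ofReal (Real.exp (√c * ⟪(u : V), m⟫ - ‖m‖ ^ 2 / 2))) ?_ ?_ ha hρ
    · intro r hr
      have : √c ≤ r := Real.sqrt_le_iff.2 ⟨r.2.out.le, hr.le⟩
      have := mul_le_mul_of_nonpos_right this (hm _ hu)
      gcongr
    · intro r hr
      have : (r : ℝ) ≤ √c := Real.le_sqrt_of_sq_le (not_lt.1 hr)
      have := mul_le_mul_of_nonpos_right this (hm _ hu)
      gcongr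
  · have h1 : {r : Set.Ioi (0 : ℝ) | (r : ℝ) • (u : V) ∈ C ∩ {x | c < ‖x‖ ^ 2}} = ∅ := by
      refine Set.eq_empty_of_forall_notMem fun r hr => hu ?_
      have := hsmul _ hr.1 (r : ℝ)⁻¹ (inv_pos.2 r.2)
      rwa [smul_smul, inv_mul_cancel₀ r.2.out.ne', one_smul] at this
    rw [h1]
    simp

/-- The standard Gaussian measure splits along orthogonal complements. -/
lemma map_add_prod_stdGaussian (L : Submodule ℝ V) :
    ((stdGaussian L).prod (stdGaussian Lᗮ)).map (fun p => (p.1 : V) + (p.2 : V))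
      = stdGaussian V := by
  have hmeas : Measurable fun p : L × Lᗮ => (p.1 : V) + (p.2 : V) := by fun_prop
  have : IsProbabilityMeasure
      (((stdGaussian L).prod (stdGaussian Lᗮ)).map fun p => (p.1 : V) + (p.2 : V)) :=
    Measure.isProbabilityMeasure_map hmeas.aemeasurable
  refine Measure.ext_of_charFun (funext fun t => ?_)
  have h1 : ∀ x : L, ⟪(x : V), t⟫ = ⟪x, L.orthogonalProjectionOnto t⟫ :=
    fun x => (Submodule.inner_orthogonalProjectionOnto_eq_of_mem_left x t).symm
  have h2 : ∀ x : Lᗮ, ⟪(x : V), t⟫ = ⟪x, Lᗮ.orthogonalProjectionOnto t⟫ :=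
    fun x => (Submodule.inner_orthogonalProjectionOnto_eq_of_mem_left x t).symm
  rw [charFun_stdGaussian, charFun_apply, integral_map (by fun_prop) (by fun_prop)]
  simp_rw [inner_add_left, Complex.ofReal_add, add_mul, Complex.exp_add, h1, h2]
  rw [integral_prod_mul (fun x : L => Complex.exp (⟪x, L.orthogonalProjectionOnto t⟫ * Complex.I))
    (fun x : Lᗮ => Complex.exp (⟪x, Lᗮ.orthogonalProjectionOnto t⟫ * Complex.I)),
    ← charFun_apply, ← charFun_apply, charFun_stdGaussian, charFun_stdGaussian, ← Complex.exp_add]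
  have h3 : (‖t‖ : ℂ) ^ 2
      = ‖L.orthogonalProjectionOnto t‖ ^ 2 + ‖Lᗮ.orthogonalProjectionOnto t‖ ^ 2 := by
    exact_mod_cast Submodule.norm_sq_eq_add_norm_sq_projection t L
  rw [h3]
  congr 1
  ring

/-- A version of `gaussian_cone_tail_le` for a product of a cone in a subspace `L` with a set in
the orthogonal complement of `L`. -/
lemma gaussian_product_tail_le (L : Submodule ℝ V) [Nontrivial L] {C : Set L} (hC : MeasurableSet C)
    (hsmul : ∀ x ∈ C, ∀ r : ℝ, 0 < r → r • x ∈ C) {D : Set Lᗮ} (hD : MeasurableSet D)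
    {m : V} (hm : ∀ x ∈ C, ⟪(x : V), m⟫ ≤ 0) {c : ℝ} {a : ℝ≥0∞} (ha : a ≤ 1)
    (hc : stdGaussian L {x | c < ‖x‖ ^ 2} ≤ a) :
    (stdGaussian V).map (fun x => m + x) {x | (L.orthogonalProjectionOnto x ∈ C ∧
        Lᗮ.orthogonalProjectionOnto x ∈ D) ∧ c < ‖L.orthogonalProjectionOnto x‖ ^ 2}
      ≤ a * (stdGaussian V).map (fun x => m + x) {x | L.orthogonalProjectionOnto x ∈ C ∧
        Lᗮ.orthogonalProjectionOnto x ∈ D} := by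
  set m₁ := L.orthogonalProjectionOnto m
  set m₂ := Lᗮ.orthogonalProjectionOnto m
  have hT : MeasurableSet {x : L | c < ‖x‖ ^ 2} := measurableSet_lt (by fun_prop) (by fun_prop)
  have key : ∀ C' : Set L, MeasurableSet C' →
      (stdGaussian V).map (fun x => m + x) {x | L.orthogonalProjectionOnto x ∈ C' ∧
        Lᗮ.orthogonalProjectionOnto x ∈ D}
      = (stdGaussian L).map (fun x => m₁ + x) C' * (stdGaussian Lᗮ).map (fun x => m₂ + x) D := by
    intro C' hC'
    have hS : MeasurableSet {x | L.orthogonalProjectionOnto x ∈ C' ∧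
        Lᗮ.orthogonalProjectionOnto x ∈ D} :=
      (L.orthogonalProjectionOnto.measurable hC').inter (Lᗮ.orthogonalProjectionOnto.measurable hD)
    rw [← map_add_prod_stdGaussian L, Measure.map_map (by fun_prop) (by fun_prop),
      Measure.map_apply (by fun_prop) hS, Measure.map_apply (by fun_prop) hC',
      Measure.map_apply (by fun_prop) hD, ← Measure.prod_prod]
    congr 1
    ext ⟨x, y⟩
    have h1 : L.orthogonalProjectionOnto (y : V) = 0 :=
      Submodule.orthogonalProjectionOnto_apply_of_mem_orthogonal y.2
    have h2 : Lᗮ.orthogonalProjectionOnto (x : V) = 0 :=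
      Submodule.orthogonalProjectionOnto_apply_of_mem_orthogonal
        (L.le_orthogonal_orthogonal x.2)
    simp [h1, h2, m₁, m₂]
  have hm₁ : ∀ x ∈ C, ⟪x, m₁⟫ ≤ 0 := fun x hx => by
    rw [Submodule.inner_orthogonalProjectionOnto_eq_of_mem_left]
    exact hm x hx
  have h := gaussian_cone_tail_le hC hsmul hm₁ ha hc
  have hset : {x | (L.orthogonalProjectionOnto x ∈ C ∧ Lᗮ.orthogonalProjectionOnto x ∈ D) ∧
      c < ‖L.orthogonalProjectionOnto x‖ ^ 2}
      = {x | L.orthogonalProjectionOnto x ∈ C ∩ {x | c < ‖x‖ ^ 2} ∧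
        Lᗮ.orthogonalProjectionOnto x ∈ D} := by
    ext x
    simp only [Set.mem_ofPred_eq, Set.mem_inter_iff]
    tauto
  rw [hset, key _ (hC.inter hT), key _ hC, ← mul_assoc]
  gcongr

lemma map_const_add_stdGaussian_hyperplane (m : V) {v : V} (hv : v ≠ 0) :
    (stdGaussian V).map (fun x => m + x) {x | ⟪v, x⟫ = 0} = 0 := by
  have hmeas : MeasurableSet {x : V | ⟪v, x⟫ = 0} :=
    measurableSet_eq_fun (by fun_prop) (by fun_prop)
  have h0 : volume {x : V | ⟪v, x⟫ = 0} = 0 := by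
    have := Measure.addHaar_submodule (volume : Measure V) (ℝ ∙ v)ᗮ (by
      intro h
      have : v ∈ (ℝ ∙ v)ᗮ := h ▸ Submodule.mem_top
      exact hv (inner_self_eq_zero.1 (Submodule.mem_orthogonal_singleton_iff_inner_right.1 this)))
    convert this using 2
    ext x
    simp [Submodule.mem_orthogonal_singleton_iff_inner_right]
  rw [map_const_add_stdGaussian_apply m hmeas, lintegral_indicator hmeas]
  exact setLIntegral_measure_zero _ _ h0

instance isProbabilityMeasure_chiSquared (k : ℕ) : IsProbabilityMeasure (chiSquared k) :=
  Measure.isProbabilityMeasure_map (Measurable.aemeasurable (by fun_prop))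

/-- The squared norm of a standard Gaussian vector is `χ²`-distributed. -/
lemma stdGaussian_norm_sq_gt (c : ℝ) :
    stdGaussian V {x | c < ‖x‖ ^ 2} = chiSquared (finrank ℝ V) (Set.Ioi c) := by
  have hT : MeasurableSet {x : V | c < ‖x‖ ^ 2} := measurableSet_lt (by fun_prop) (by fun_prop)
  rw [stdGaussian, chiSquared, Measure.map_apply (by fun_prop) hT,
    Measure.map_apply (by fun_prop) measurableSet_Ioi]
  congr 1
  ext z
  have : ‖∑ i, z i • stdOrthonormalBasis ℝ V i‖ ^ 2 = ∑ i, z i ^ 2 := by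
    rw [← real_inner_self_eq_norm_sq, Orthonormal.inner_sum (stdOrthonormalBasis ℝ V).orthonormal]
    simp [sq]
  simp [this]

lemma chiSquaredQuantile_nonneg {p : ℝ} (hp : 0 < p) (k : ℕ) : 0 ≤ chiSquaredQuantile p k := by
  refine Real.sInf_nonneg fun x (hx : p ≤ _) => ?_
  by_contra! hneg
  have h0 : chiSquared k (Set.Iic x) = 0 := by
    rw [chiSquared, Measure.map_apply (by fun_prop) measurableSet_Iic]
    convert measure_empty (μ := Measure.pi fun _ : Fin k => gaussianReal 0 1)
    refine Set.eq_empty_of_forall_notMem fun z (hz : _ ≤ x) => ?_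
    exact absurd (Finset.sum_nonneg fun i _ => sq_nonneg (z i)) (not_le.2 (hz.trans_lt hneg))
  rw [cdf_eq_real, measureReal_def, h0] at hx
  simp at hx
  linarith

/-- Right continuity makes the cdf at least `p` at the infimum defining the quantile. Continuity of
the cdf is not needed for this inequality. -/
lemma chiSquared_quantile_tail_le {p : ℝ} (hp : p ∈ Set.Ioo (0 : ℝ) 1) (k : ℕ) :
    chiSquared k (Set.Ioi (chiSquaredQuantile p k)) ≤ ENNReal.ofReal (1 - p) := by
  have hne : {x : ℝ | p ≤ cdf (chiSquared k) x}.Nonempty :=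
    (((tendsto_cdf_atTop (chiSquared k)).eventually (eventually_ge_nhds hp.2)).exists)
  have hcdf : p ≤ cdf (chiSquared k) (chiSquaredQuantile p k) := by
    have hcont := (cdf (chiSquared k)).right_continuous (chiSquaredQuantile p k)
    refine ge_of_tendsto (hcont.mono_left (nhdsWithin_mono _ Set.Ioi_subset_Ici_self)) ?_
    filter_upwards [self_mem_nhdsWithin] with x hx
    obtain ⟨y, hy, hyx⟩ := exists_lt_of_csInf_lt hne hx
    exact hy.trans (monotone_cdf _ hyx.le)
  rw [cdf_eq_real] at hcdf
  rw [← Set.compl_Iic, prob_compl_eq_one_sub measurableSet_Iic, ENNReal.ofReal_sub _ hp.1.le,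
    ENNReal.ofReal_one]
  gcongr
  exact ENNReal.ofReal_le_of_le_toReal hcdf

end Gaussian

/-! ### Faces of polyhedral cones and their relative interiors. -/

section Faces

open Module
open scoped RealInnerProductSpace

variable {E ι : Type*} [NormedAddCommGroup E] [InnerProductSpace ℝ E]

/-- The polyhedral cone `{x | ⟪a j, x⟫ ≤ 0 for j ∈ J}`. -/
def negDual (a : ι → E) (J : Finset ι) : Set E :=
  {x | ∀ j ∈ J, ⟪a j, x⟫ ≤ 0}

open scoped Classical in
/-- The indices of the constraints of `negDual a J` that are active at `u`. -/
def active (a : ι → E) (J : Finset ι) (u : E) : Finset ι :=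
  {j ∈ J | ⟪a j, u⟫ = 0}

lemma mem_active {a : ι → E} {J : Finset ι} {u : E} {j : ι} :
    j ∈ active a J u ↔ j ∈ J ∧ ⟪a j, u⟫ = 0 := by
  simp [active]

lemma active_subset (a : ι → E) (J : Finset ι) (u : E) : active a J u ⊆ J :=
  fun _ h => (mem_active.1 h).1

/-- The subspace orthogonal to the `a j`, `j ∈ A`. -/
def orthSpace (a : ι → E) (A : Finset ι) : Submodule ℝ E :=
  (Submodule.span ℝ (a '' A))ᗮ

lemma mem_orthSpace {a : ι → E} {A : Finset ι} {x : E} :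
    x ∈ orthSpace a A ↔ ∀ j ∈ A, ⟪a j, x⟫ = 0 := by
  rw [orthSpace, Submodule.mem_orthogonal]
  refine ⟨fun h j hj => h _ (Submodule.subset_span ⟨j, hj, rfl⟩), fun h y hy => ?_⟩
  induction hy using Submodule.span_induction with
  | mem y hy => obtain ⟨j, hj, rfl⟩ := hy; exact h j hj
  | zero => simp
  | add y z _ _ hy hz => rw [inner_add_left, hy, hz, add_zero]
  | smul c y _ hy => rw [real_inner_smul_left, hy, mul_zero]

lemma finrank_orthSpace [FiniteDimensional ℝ E] {a : ι → E} {A : Finset ι}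
    (hA : LinearIndependent ℝ fun j : A => a j) :
    finrank ℝ (orthSpace a A) = finrank ℝ E - A.card := by
  have h1 : finrank ℝ (Submodule.span ℝ (a '' A)) = A.card := by
    have := finrank_span_eq_card hA
    rw [Fintype.card_coe] at this
    rwa [show Set.range (fun j : A => a j) = a '' A from (Set.image_eq_range _ _).symm] at this
  have h2 := (Submodule.span ℝ (a '' A)).finrank_add_finrank_orthogonal
  rw [orthSpace]
  omega

/-- The face of `negDual a J` that has `u` in its relative interior. -/
def activeFace (a : ι → E) (J : Finset ι) (u : E) : Set E :=
  negDual a J ∩ orthSpace a (active a J u)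

/-- Inactive constraints are strict at `u` and remain so nearby, so the face fills a neighbourhood
of `u` in its subspace. This yields both the span and the relative interior. -/
lemma eventually_mem_activeFace {a : ι → E} {J : Finset ι} {u : E} (hu : u ∈ negDual a J) :
    ∀ᶠ x in nhds u, x ∈ orthSpace a (active a J u) → x ∈ activeFace a J u := by
  have h : ∀ᶠ x in nhds u, ∀ j ∈ J, j ∉ active a J u → ⟪a j, x⟫ ≤ 0 := by
    refine (Finset.eventually_all J).2 fun j hj => ?_
    by_cases hjA : j ∈ active a J u
    · simp [hjA]
    · have hlt : ⟪a j, u⟫ < 0 := lt_of_le_of_ne (hu j hj) fun h => hjA (mem_active.2 ⟨hj, h⟩)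
      have hc : Continuous fun x => ⟪a j, x⟫ := by fun_prop
      filter_upwards [hc.continuousAt.eventually_lt_const hlt] with x hx _ using hx.le
  filter_upwards [h] with x hx hxL
  refine ⟨fun j hj => ?_, hxL⟩
  by_cases hjA : j ∈ active a J u
  · exact (mem_orthSpace.1 hxL j hjA).le
  · exact hx j hj hjA

lemma mem_activeFace_self {a : ι → E} {J : Finset ι} {u : E} (hu : u ∈ negDual a J) :
    u ∈ activeFace a J u :=
  ⟨hu, mem_orthSpace.2 fun _ hj => (mem_active.1 hj).2⟩

lemma exists_pos_add_smul_mem_activeFace {a : ι → E} {J : Finset ι} {u z : E}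
    (hu : u ∈ negDual a J) (hz : z ∈ orthSpace a (active a J u)) :
    ∃ t : ℝ, 0 < t ∧ u + t • z ∈ activeFace a J u := by
  have hc : Filter.Tendsto (fun t : ℝ => u + t • z) (nhds 0) (nhds u) := by
    have : Continuous fun t : ℝ => u + t • z := by fun_prop
    simpa using this.tendsto 0
  have h := (hc.eventually (eventually_mem_activeFace hu)).filter_mono
    (nhdsWithin_le_nhds (s := Set.Ioi 0))
  obtain ⟨t, ht, ht0⟩ := (h.and self_mem_nhdsWithin).exists
  exact ⟨t, ht0, ht (add_mem (mem_activeFace_self hu).2 (Submodule.smul_mem _ _ hz))⟩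

lemma span_activeFace {a : ι → E} {J : Finset ι} {u : E} (hu : u ∈ negDual a J) :
    Submodule.span ℝ (activeFace a J u) = orthSpace a (active a J u) := by
  refine le_antisymm (Submodule.span_le.2 Set.inter_subset_right) fun z hz => ?_
  obtain ⟨t, ht, h⟩ := exists_pos_add_smul_mem_activeFace hu hz
  have h1 := sub_mem (Submodule.subset_span (R := ℝ) h)
    (Submodule.subset_span (mem_activeFace_self hu))
  rw [add_sub_cancel_left] at h1
  exact (Submodule.smul_mem_iff _ ht.ne').1 h1

lemma convex_negDual (a : ι → E) (J : Finset ι) : Convex ℝ (negDual a J) := by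
  intro x hx y hy s t hs ht _ j hj
  rw [inner_add_right, real_inner_smul_right, real_inner_smul_right]
  nlinarith [mul_nonneg hs (neg_nonneg.2 (hx j hj)), mul_nonneg ht (neg_nonneg.2 (hy j hj))]

lemma convex_activeFace (a : ι → E) (J : Finset ι) (u : E) : Convex ℝ (activeFace a J u) :=
  (convex_negDual a J).inter (Submodule.convex _)

lemma isExtreme_activeFace (a : ι → E) (J : Finset ι) (u : E) :
    IsExtreme ℝ (negDual a J) (activeFace a J u) := by
  refine ⟨Set.inter_subset_left, ?_⟩
  rintro x hx y hy z hz ⟨s, t, hs, ht, -, rfl⟩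
  refine ⟨hx, mem_orthSpace.2 fun j hj => ?_⟩
  have h := mem_orthSpace.1 hz.2 j hj
  rw [inner_add_right, real_inner_smul_right, real_inner_smul_right] at h
  have hx' := hx j (mem_active.1 hj).1
  have hy' := hy j (mem_active.1 hj).1
  nlinarith [mul_nonneg ht.le (neg_nonneg.2 hy'), mul_nonneg hs.le (neg_nonneg.2 hx')]

lemma mem_intrinsicInterior_activeFace {a : ι → E} {J : Finset ι} {u : E}
    (hu : u ∈ negDual a J) : u ∈ intrinsicInterior ℝ (activeFace a J u) := by
  rw [mem_intrinsicInterior]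
  refine ⟨⟨u, subset_affineSpan ℝ _ (mem_activeFace_self hu)⟩, ?_, rfl⟩
  rw [mem_interior_iff_mem_nhds]
  have hle : affineSpan ℝ (activeFace a J u) ≤ (orthSpace a (active a J u)).toAffineSubspace :=
    affineSpan_le.2 Set.inter_subset_right
  have h := (continuousAt_subtype_val (x := (⟨u, subset_affineSpan ℝ _ (mem_activeFace_self hu)⟩ :
    affineSpan ℝ (activeFace a J u)))).eventually (eventually_mem_activeFace hu)
  filter_upwards [h] with x hx using hx (hle x.2)

/-- From a point of the relative interior one can move a little away from any point of the set. -/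
lemma exists_pos_sub_smul_mem_of_mem_intrinsicInterior {F : Set E} {u y : E}
    (hu : u ∈ intrinsicInterior ℝ F) (hy : y ∈ F) : ∃ t : ℝ, 0 < t ∧ u - t • (y - u) ∈ F := by
  have huF := intrinsicInterior_subset hu
  obtain ⟨u', hu', rfl⟩ := mem_intrinsicInterior.1 hu
  let y' : affineSpan ℝ F := ⟨y, subset_affineSpan ℝ _ hy⟩
  have hmem : ∀ t : ℝ, AffineMap.lineMap (u' : E) y t ∈ affineSpan ℝ F :=
    fun t => AffineMap.lineMap_mem t u'.2 y'.2
  let g : ℝ → affineSpan ℝ F := fun t => ⟨AffineMap.lineMap (u' : E) y t, hmem t⟩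
  have hg : Continuous g := Continuous.subtype_mk AffineMap.lineMap_continuous _
  have hg0 : g 0 = u' := Subtype.ext (by simp [g])
  have h : ∀ᶠ t in nhds (0 : ℝ), g t ∈ interior ((↑) ⁻¹' F) :=
    hg.continuousAt.eventually (isOpen_interior.mem_nhds (by rwa [hg0]))
  obtain ⟨t, ht, ht0⟩ := ((h.filter_mono (nhdsWithin_le_nhds (s := Set.Iio 0))).and
    self_mem_nhdsWithin).exists
  refine ⟨-t, neg_pos.2 ht0, ?_⟩
  have : (g t : E) ∈ F := Set.mem_preimage.1 (interior_subset ht)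
  simpa [g, AffineMap.lineMap_apply, sub_eq_add_neg, add_comm] using this

/-- The relative interiors of the faces partition the cone. -/
lemma eq_activeFace {a : ι → E} {J : Finset ι} {F : Set E} (hF : IsExtreme ℝ (negDual a J) F)
    {u : E} (huF : u ∈ intrinsicInterior ℝ F) : F = activeFace a J u := by
  have hu : u ∈ negDual a J := hF.1 (intrinsicInterior_subset huF)
  refine Set.Subset.antisymm (fun y hy => ⟨hF.1 hy, mem_orthSpace.2 fun j hj => ?_⟩) fun y hy => ?_
  -- Moving from `u` away from `y` reverses the sign of `⟪a j, y⟫` at an active constraint, so this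
  -- product must vanish.
  · obtain ⟨t, ht, h⟩ := exists_pos_sub_smul_mem_of_mem_intrinsicInterior huF hy
    have h1 := hF.1 h j (mem_active.1 hj).1
    have h2 := hF.1 hy j (mem_active.1 hj).1
    rw [inner_sub_right, real_inner_smul_right, inner_sub_right, (mem_active.1 hj).2] at h1
    nlinarith
  · obtain ⟨t, ht, h⟩ := exists_pos_sub_smul_mem_of_mem_intrinsicInterior
      (mem_intrinsicInterior_activeFace hu) hy
    refine hF.2 hy.1 h.1 (intrinsicInterior_subset huF) ?_
    have ht' : 0 < 1 + t := by linarith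
    -- The weights solve `z = u - t • (y - u)` for `u` as a convex combination of `y` and `z`;
    -- extremality then puts `y` in `F`.
    refine ⟨t / (1 + t), 1 / (1 + t), by positivity, by positivity, by field_simp; ring, ?_⟩
    rw [← sub_eq_zero]
    have h3 : (t / (1 + t)) • y + (1 / (1 + t)) • (u - t • (y - u)) - u
      = (t / (1 + t) - 1 / (1 + t) * t) • y + (1 / (1 + t) * (1 + t) - 1) • u := by
      module
    rw [h3, one_div_mul_cancel ht'.ne', div_eq_inv_mul, one_div]
    simp

-- At most one face contributes, so the sum collapses without first proving that there are finitely
-- many faces.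
open scoped Classical in
lemma finsum_face_eq {n : ℕ} {a : ι → EuclideanSpace ℝ (Fin n)} {J : Finset ι}
    {u : EuclideanSpace ℝ (Fin n)} (hu : u ∈ negDual a J)
    (g : Set (EuclideanSpace ℝ (Fin n)) → ℝ) :
    (∑ᶠ F ∈ {F | IsFaceOf (negDual a J) F}, if u ∈ intrinsicInterior ℝ F then g F else 0)
      = g (activeFace a J u) := by
  have hface : activeFace a J u ∈ {F | IsFaceOf (negDual a J) F} :=
    ⟨⟨u, mem_activeFace_self hu⟩, convex_activeFace a J u, isExtreme_activeFace a J u⟩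
  rw [finsum_eq_single _ (activeFace a J u)]
  · rw [finsum_eq_if, if_pos hface, if_pos (mem_intrinsicInterior_activeFace hu)]
  · intro F hne
    rw [finsum_eq_if]
    split_ifs with h1 h2
    · exact absurd (eq_activeFace h1.2.2 h2) hne
    · rfl
    · rfl

end Faces

/-! ### Moreau decomposition and the partition into cells. -/

section Moreau

open Module
open scoped RealInnerProductSpace ENNReal

variable {E ι : Type*} [NormedAddCommGroup E] [InnerProductSpace ℝ E]

/-- The convex cone generated by the vectors `b j`, `j ∈ J`. -/
def posCone (b : ι → E) (J : Finset ι) : Set E :=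
  {x | ∃ l : ι → ℝ, (∀ j ∈ J, 0 ≤ l j) ∧ x = ∑ j ∈ J, l j • b j}

lemma zero_mem_posCone (b : ι → E) (J : Finset ι) : 0 ∈ posCone b J :=
  ⟨0, by simp, by simp⟩

lemma smul_mem_posCone {b : ι → E} {J : Finset ι} {x : E} (hx : x ∈ posCone b J) {c : ℝ}
    (hc : 0 ≤ c) : c • x ∈ posCone b J := by
  obtain ⟨l, hl, rfl⟩ := hx
  exact ⟨fun j => c * l j, fun j hj => mul_nonneg hc (hl j hj),
    by simp [Finset.smul_sum, smul_smul]⟩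

lemma add_mem_posCone {b : ι → E} {J : Finset ι} {x y : E} (hx : x ∈ posCone b J)
    (hy : y ∈ posCone b J) : x + y ∈ posCone b J := by
  obtain ⟨l, hl, rfl⟩ := hx
  obtain ⟨k, hk, rfl⟩ := hy
  exact ⟨fun j => l j + k j, fun j hj => add_nonneg (hl j hj) (hk j hj),
    by simp [add_smul, Finset.sum_add_distrib]⟩

lemma convex_posCone (b : ι → E) (J : Finset ι) : Convex ℝ (posCone b J) :=
  fun _ hx _ hy _ _ hs ht _ => add_mem_posCone (smul_mem_posCone hx hs) (smul_mem_posCone hy ht)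

lemma mem_posCone_of_mem {b : ι → E} {J : Finset ι} {j : ι} (hj : j ∈ J) : b j ∈ posCone b J := by
  classical
  refine ⟨Pi.single j 1, fun i _ => ?_, ?_⟩
  · by_cases h : i = j
    · subst h; simp
    · simp [h]
  · rw [Finset.sum_eq_single j (fun i _ h => by simp [h]) (fun h => absurd hj h)]
    simp

lemma posCone_subset_span (b : ι → E) (J : Finset ι) :
    posCone b J ⊆ Submodule.span ℝ (b '' J) := by
  rintro _ ⟨l, -, rfl⟩
  exact sum_mem fun j hj => Submodule.smul_mem _ _ (Submodule.subset_span ⟨j, hj, rfl⟩)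

lemma posCone_mono (b : ι → E) {A J : Finset ι} (h : A ⊆ J) : posCone b A ⊆ posCone b J := by
  classical
  rintro _ ⟨l, hl, rfl⟩
  refine ⟨fun j => if j ∈ A then l j else 0, fun j _ => ?_, ?_⟩
  · by_cases hj : j ∈ A
    · simpa [hj] using hl j hj
    · simp [hj]
  · simp only [ite_smul, zero_smul]
    rw [← Finset.sum_filter, Finset.filter_mem_eq_inter, Finset.inter_eq_right.2 h]

lemma inner_nonpos_of_mem {b : ι → E} {J : Finset ι} {x z : E} (hx : x ∈ negDual b J)
    (hz : z ∈ posCone b J) : ⟪x, z⟫ ≤ 0 := by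
  obtain ⟨l, hl, rfl⟩ := hz
  rw [inner_sum]
  refine Finset.sum_nonpos fun j hj => ?_
  rw [real_inner_smul_right, real_inner_comm]
  exact mul_nonpos_of_nonneg_of_nonpos (hl j hj) (hx j hj)

lemma linearIndependent_subset {b : ι → E} {A J : Finset ι}
    (hb : LinearIndependent ℝ fun j : J => b j) (hA : A ⊆ J) :
    LinearIndependent ℝ fun j : A => b j :=
  hb.comp (fun j : A => (⟨j, hA j.2⟩ : J)) fun _ _ h => Subtype.ext (by simpa using h)

/-- Independence makes the cone the image of a closed orthant under an injective linear map, which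
is a closed embedding. -/
lemma isClosed_posCone [FiniteDimensional ℝ E] {b : ι → E} {J : Finset ι}
    (hb : LinearIndependent ℝ fun j : J => b j) : IsClosed (posCone b J) := by
  classical
  have hinj : LinearMap.ker (Fintype.linearCombination ℝ fun j : J => b j) = ⊥ :=
    LinearMap.ker_eq_bot.2 hb.fintypeLinearCombination_injective
  have hemb := LinearMap.isClosedEmbedding_of_injective hinj
  have : posCone b J = (Fintype.linearCombination ℝ fun j : J => b j) '' {l | 0 ≤ l} := by
    ext x
    constructor
    · rintro ⟨l, hl, rfl⟩
      refine ⟨fun j => l j, fun j => hl j j.2, ?_⟩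
      rw [Fintype.linearCombination_apply, Finset.sum_coe_sort J fun j => l j • b j]
    · rintro ⟨l, hl, rfl⟩
      refine ⟨fun j => if h : j ∈ J then l ⟨j, h⟩ else 0, fun j hj => ?_, ?_⟩
      · simpa [hj] using hl ⟨j, hj⟩
      · rw [Fintype.linearCombination_apply, ← Finset.sum_coe_sort J]
        simp
  rw [this]
  exact hemb.isClosedMap _ isClosed_Ici

/-- `x = u + (x - u)` is the Moreau decomposition of `x` along the polar pair of cones
`negDual b J` and `posCone b J`. -/
structure IsMoreau (b : ι → E) (J : Finset ι) (x u : E) : Prop where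
  mem_negDual : u ∈ negDual b J
  sub_mem_posCone : x - u ∈ posCone b J
  inner_eq_zero : ⟪u, x - u⟫ = 0

lemma exists_isMoreau [FiniteDimensional ℝ E] {b : ι → E} {J : Finset ι}
    (hb : LinearIndependent ℝ fun j : J => b j) (x : E) : ∃ u, IsMoreau b J x u := by
  obtain ⟨v, hv, hmin⟩ := exists_norm_eq_iInf_of_complete_convex ⟨0, zero_mem_posCone b J⟩
    (isClosed_posCone hb).isComplete (convex_posCone b J) x
  have h := (norm_eq_iInf_iff_real_inner_le_zero (convex_posCone b J) hv).1 hmin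
  have h0 : ⟪x - v, v⟫ = 0 := by
    -- Testing the variational inequality at `0` and at `2 • v` gives orthogonality.
    have h1 := h 0 (zero_mem_posCone b J)
    have h2 := h ((2 : ℝ) • v) (smul_mem_posCone hv zero_le_two)
    rw [zero_sub, inner_neg_right] at h1
    rw [two_smul, add_sub_cancel_right] at h2
    linarith
  refine ⟨x - v, fun j hj => ?_, by rwa [sub_sub_cancel], by rwa [sub_sub_cancel]⟩
  have h1 := h _ (mem_posCone_of_mem hj)
  rw [inner_sub_right, h0, sub_zero] at h1
  rwa [real_inner_comm]

namespace IsMoreau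

variable {b : ι → E} {J : Finset ι} {x u : E}

/-- The extra term `‖u - z‖²` gives uniqueness of the nearest point together with minimality. -/
lemma norm_sub_sq_add_le (h : IsMoreau b J x u) {z : E} (hz : z ∈ negDual b J) :
    ‖x - u‖ ^ 2 + ‖u - z‖ ^ 2 ≤ ‖x - z‖ ^ 2 := by
  have h1 := inner_nonpos_of_mem hz h.sub_mem_posCone
  have h2 : x - z = (x - u) + (u - z) := by abel
  rw [h2, norm_add_sq_real, inner_sub_right, real_inner_comm, h.inner_eq_zero, real_inner_comm]
  linarith

lemma norm_sq_add_le (h : IsMoreau b J x u) {z : E} (hz : z ∈ posCone b J) :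
    ‖u‖ ^ 2 + ‖x - u - z‖ ^ 2 ≤ ‖x - z‖ ^ 2 := by
  have h1 := inner_nonpos_of_mem h.mem_negDual hz
  have h2 : x - z = u + (x - u - z) := by abel
  rw [h2, norm_add_sq_real, inner_sub_right, h.inner_eq_zero]
  linarith

lemma unique (h : IsMoreau b J x u) {u' : E} (h' : IsMoreau b J x u') : u = u' := by
  have h1 := h.norm_sub_sq_add_le h'.mem_negDual
  have h2 := h'.norm_sub_sq_add_le h.mem_negDual
  have h3 : ‖u - u'‖ ^ 2 ≤ 0 := by nlinarith [sq_nonneg ‖u' - u‖]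
  rw [← sub_eq_zero, ← norm_eq_zero]
  exact pow_eq_zero_iff two_ne_zero |>.1 (le_antisymm h3 (sq_nonneg _))

lemma mem_orthSpace (h : IsMoreau b J x u) : u ∈ orthSpace b (active b J u) :=
  (mem_activeFace_self h.mem_negDual).2

/-- Complementary slackness: `⟪u, x - u⟫ = 0` is a sum of nonpositive terms, so coefficients at
inactive constraints vanish or multiply nothing. -/
lemma sub_mem_posCone_active (h : IsMoreau b J x u) : x - u ∈ posCone b (active b J u) := by
  obtain ⟨l, hl, hx⟩ := h.sub_mem_posCone
  refine ⟨l, fun j hj => hl j (active_subset _ _ _ hj), ?_⟩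
  rw [hx]
  refine (Finset.sum_subset (active_subset b J u) fun j hj hjA => ?_).symm
  have h0 := h.inner_eq_zero
  rw [hx, inner_sum, Finset.sum_eq_zero_iff_of_nonpos] at h0
  · have := h0 j hj
    rw [real_inner_smul_right, real_inner_comm] at this
    rcases mul_eq_zero.1 this with h1 | h1
    · rw [h1, zero_smul]
    · exact absurd (mem_active.2 ⟨hj, h1⟩) hjA
  · intro i hi
    rw [real_inner_smul_right, real_inner_comm]
    exact mul_nonpos_of_nonneg_of_nonpos (hl i hi) (h.mem_negDual i hi)

end IsMoreau

variable [FiniteDimensional ℝ E]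

/-- The part in `orthSpace b A` of the vectors with active set `A`. -/
def openFace (b : ι → E) (J A : Finset ι) : Set (orthSpace b A) :=
  {z | ∀ j ∈ J, j ∉ A → ⟪b j, (z : E)⟫ < 0}

/-- The part in the complement of `orthSpace b A` of the vectors with active set `A`. -/
def normalCone (b : ι → E) (A : Finset ι) : Set (orthSpace b A)ᗮ :=
  {z | (z : E) ∈ posCone b A}

/-- The set of the vectors whose projection onto `negDual b J` has active set `A`. -/
def cell (b : ι → E) (J A : Finset ι) : Set E :=
  {x | (orthSpace b A).orthogonalProjectionOnto x ∈ openFace b J A ∧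
    (orthSpace b A)ᗮ.orthogonalProjectionOnto x ∈ normalCone b A}

lemma orthSpace_orthogonal (b : ι → E) (A : Finset ι) :
    (orthSpace b A)ᗮ = Submodule.span ℝ (b '' A) :=
  Submodule.orthogonal_orthogonal _

lemma IsMoreau.projection_eq {b : ι → E} {J : Finset ι} {x u : E} (h : IsMoreau b J x u) :
    ((orthSpace b (active b J u)).orthogonalProjectionOnto x : E) = u ∧
      ((orthSpace b (active b J u))ᗮ.orthogonalProjectionOnto x : E) = x - u := by
  set L := orthSpace b (active b J u)
  have h1 : x - u ∈ Lᗮ := by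
    rw [orthSpace_orthogonal]
    exact posCone_subset_span _ _ h.sub_mem_posCone_active
  have h2 : L.orthogonalProjectionOnto x = (⟨u, h.mem_orthSpace⟩ : L) := by
    conv_lhs => rw [← add_sub_cancel u x, map_add]
    rw [Submodule.orthogonalProjectionOnto_apply_of_mem_orthogonal h1, add_zero]
    exact Submodule.orthogonalProjectionOnto_mem_subspace_eq_self (⟨u, h.mem_orthSpace⟩ : L)
  have h3 : Lᗮ.orthogonalProjectionOnto x = (⟨x - u, h1⟩ : Lᗮ) := by
    conv_lhs => rw [← add_sub_cancel u x, map_add]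
    rw [Submodule.orthogonalProjectionOnto_apply_of_mem_orthogonal
      (L.le_orthogonal_orthogonal h.mem_orthSpace), zero_add]
    exact Submodule.orthogonalProjectionOnto_mem_subspace_eq_self (⟨x - u, h1⟩ : Lᗮ)
  exact ⟨by rw [h2], by rw [h3]⟩

lemma IsMoreau.mem_cell {b : ι → E} {J : Finset ι} {x u : E} (h : IsMoreau b J x u) :
    x ∈ cell b J (active b J u) := by
  refine ⟨fun j hj hjA => ?_, ?_⟩
  · rw [h.projection_eq.1]
    exact lt_of_le_of_ne (h.mem_negDual j hj) fun h0 => hjA (mem_active.2 ⟨hj, h0⟩)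
  · rw [normalCone, Set.mem_ofPred_eq, h.projection_eq.2]
    exact h.sub_mem_posCone_active

/-- The converse of `IsMoreau.mem_cell`. With uniqueness of the decomposition it makes cells of
distinct active sets disjoint. -/
lemma isMoreau_of_mem_cell {b : ι → E} {J A : Finset ι} (hA : A ⊆ J) {x : E}
    (hx : x ∈ cell b J A) :
    IsMoreau b J x ((orthSpace b A).orthogonalProjectionOnto x) ∧
      active b J ((orthSpace b A).orthogonalProjectionOnto x : E) = A := by
  set L := orthSpace b A
  have hL : ∀ j ∈ A, ⟪b j, (L.orthogonalProjectionOnto x : E)⟫ = 0 :=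
    mem_orthSpace.1 (L.orthogonalProjectionOnto x).2
  have hsub : x - L.orthogonalProjectionOnto x = (Lᗮ.orthogonalProjectionOnto x : E) := by
    rw [sub_eq_iff_eq_add']
    exact (L.starProjection_add_starProjection_orthogonal x).symm
  refine ⟨⟨fun j hj => ?_, ?_, ?_⟩, ?_⟩
  · by_cases hjA : j ∈ A
    · exact (hL j hjA).le
    · exact (hx.1 j hj hjA).le
  · rw [hsub]
    exact posCone_mono b hA hx.2
  · rw [hsub]
    exact Submodule.inner_right_of_mem_orthogonal (Subtype.coe_prop _) (Subtype.coe_prop _)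
  · ext j
    rw [mem_active]
    refine ⟨fun h => ?_, fun h => ⟨hA h, hL j h⟩⟩
    by_contra hjA
    exact (hx.1 j h.1 hjA).ne h.2

lemma disjoint_cell {b : ι → E} {J A A' : Finset ι} (hA : A ⊆ J) (hA' : A' ⊆ J) (hne : A ≠ A') :
    Disjoint (cell b J A) (cell b J A') := by
  refine Set.disjoint_left.2 fun x hx hx' => hne ?_
  obtain ⟨h1, h2⟩ := isMoreau_of_mem_cell hA hx
  obtain ⟨h1', h2'⟩ := isMoreau_of_mem_cell hA' hx'
  rw [← h2, ← h2', h1.unique h1']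

variable [MeasurableSpace E] [BorelSpace E]

lemma measurableSet_openFace (b : ι → E) (J A : Finset ι) : MeasurableSet (openFace b J A) := by
  have : openFace b J A = ⋂ j ∈ J, {z : orthSpace b A | j ∉ A → ⟪b j, (z : E)⟫ < 0} := by
    ext z; simp [openFace]
  rw [this]
  refine Finset.measurableSet_biInter J fun j _ => ?_
  by_cases hj : j ∈ A
  · simp [hj]
  · simp only [hj, not_false_eq_true, true_imp_iff]
    exact measurableSet_lt (by fun_prop) (by fun_prop)

lemma measurableSet_normalCone {b : ι → E} {A : Finset ι}
    (hb : LinearIndependent ℝ fun j : A => b j) : MeasurableSet (normalCone b A) :=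
  measurable_subtype_coe (isClosed_posCone hb).measurableSet

lemma measurableSet_cell {b : ι → E} {A : Finset ι} (J : Finset ι)
    (hb : LinearIndependent ℝ fun j : A => b j) : MeasurableSet (cell b J A) :=
  ((orthSpace b A).orthogonalProjectionOnto.measurable (measurableSet_openFace b J A)).inter
    ((orthSpace b A)ᗮ.orthogonalProjectionOnto.measurable (measurableSet_normalCone hb))

/-- The size bound for a Gaussian vector whose mean lies in the cone, with a critical value that
depends on the active set of the projection onto the polar cone. -/
lemma gaussian_isMoreau_tail_le {b : ι → E} {J : Finset ι}
    (hb : LinearIndependent ℝ fun j : J => b j) {m : E} (hm : m ∈ posCone b J)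
    {crit : Finset ι → ℝ} (hcrit : ∀ A ⊆ J, 0 ≤ crit A) {a : ℝ≥0∞} (ha : a ≤ 1)
    (htail : ∀ A ⊆ J, Nontrivial (orthSpace b A) →
      stdGaussian (orthSpace b A) {x | crit A < ‖x‖ ^ 2} ≤ a) :
    (stdGaussian E).map (fun x => m + x)
      {x | ∃ u, IsMoreau b J x u ∧ crit (active b J u) < ‖u‖ ^ 2} ≤ a := by
  set N := (stdGaussian E).map (fun x => m + x)
  have : IsProbabilityMeasure N := Measure.isProbabilityMeasure_map (by fun_prop)
  have hcell : ∀ A ∈ J.powerset, N {x | x ∈ cell b J A ∧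
      crit A < ‖(orthSpace b A).orthogonalProjectionOnto x‖ ^ 2} ≤ a * N (cell b J A) := by
    intro A hA
    rw [Finset.mem_powerset] at hA
    -- If `orthSpace b A` is zero, then the projection vanishes and cannot exceed a nonnegative
    -- critical value.
    rcases subsingleton_or_nontrivial (orthSpace b A) with hL | hL
    · have : {x | x ∈ cell b J A ∧ crit A < ‖(orthSpace b A).orthogonalProjectionOnto x‖ ^ 2}
          = ∅ := by
        refine Set.eq_empty_of_forall_notMem fun x hx => ?_
        have h0 : (orthSpace b A).orthogonalProjectionOnto x = 0 := Subsingleton.elim _ _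
        have := hx.2
        rw [h0, norm_zero, zero_pow two_ne_zero] at this
        exact absurd (hcrit A hA) (not_le.2 this)
      rw [this, measure_empty]
      exact zero_le
    · refine gaussian_product_tail_le _ (measurableSet_openFace b J A) (fun x hx r hr j hj hjA => ?_)
        (measurableSet_normalCone (linearIndependent_subset hb hA)) (fun x hx => ?_) ha
        (htail A hA hL)
      · rw [Submodule.coe_smul, real_inner_smul_right]
        exact mul_neg_of_pos_of_neg hr (hx j hj hjA)
      · refine inner_nonpos_of_mem (fun j hj => ?_) hm
        by_cases hjA : j ∈ A
        · exact (mem_orthSpace.1 x.2 j hjA).le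
        · exact (hx j hj hjA).le
  -- The events are only bounded by subadditivity; the measurable disjoint cells have masses that
  -- add up to at most one.
  calc N {x | ∃ u, IsMoreau b J x u ∧ crit (active b J u) < ‖u‖ ^ 2}
      ≤ N (⋃ A ∈ J.powerset, {x | x ∈ cell b J A ∧
          crit A < ‖(orthSpace b A).orthogonalProjectionOnto x‖ ^ 2}) := by
        refine measure_mono ?_
        rintro x ⟨u, hu, hlt⟩
        refine Set.mem_biUnion (Finset.mem_coe.2 (Finset.mem_powerset.2 (active_subset b J u)))
          ⟨hu.mem_cell, ?_⟩
        rwa [← Submodule.norm_coe, hu.projection_eq.1]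
    _ ≤ ∑ A ∈ J.powerset, N {x | x ∈ cell b J A ∧
          crit A < ‖(orthSpace b A).orthogonalProjectionOnto x‖ ^ 2} :=
        measure_biUnion_finset_le _ _
    _ ≤ ∑ A ∈ J.powerset, a * N (cell b J A) := Finset.sum_le_sum hcell
    _ = a * N (⋃ A ∈ J.powerset, cell b J A) := by
        rw [← Finset.mul_sum, measure_biUnion_finset]
        · intro A hA A' hA' hne
          exact disjoint_cell (Finset.mem_powerset.1 hA) (Finset.mem_powerset.1 hA') hne
        · exact fun A hA => measurableSet_cell J
            (linearIndependent_subset hb (Finset.mem_powerset.1 hA))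
    _ ≤ a * 1 := by gcongr; exact prob_le_one
    _ = a := mul_one a

/-- Almost surely, the projection onto the polar cone is orthogonal to a further generator only if
this is forced by the active constraints. -/
lemma gaussian_ae_inner_ne_zero [Countable ι] (b : ι → E) (J : Finset ι) (m : E) :
    ∀ᵐ x ∂(stdGaussian E).map (fun x => m + x), ∀ u, IsMoreau b J x u →
      ∀ j, b j ∉ Submodule.span ℝ (b '' active b J u) → ⟪b j, u⟫ ≠ 0 := by
  have h : ∀ᵐ x ∂(stdGaussian E).map (fun x => m + x), ∀ A : Finset ι, ∀ j,
      b j ∉ Submodule.span ℝ (b '' A) → ⟪(orthSpace b A).starProjection (b j), x⟫ ≠ 0 := by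
    refine ae_all_iff.2 fun A => ae_all_iff.2 fun j => ?_
    by_cases hj : b j ∈ Submodule.span ℝ (b '' A)
    · simp [hj]
    · have hne : (orthSpace b A).starProjection (b j) ≠ 0 := by
        rwa [ne_eq, Submodule.starProjection_apply_eq_zero_iff, orthSpace_orthogonal]
      have h0 := map_const_add_stdGaussian_hyperplane m hne
      filter_upwards [compl_mem_ae_iff.2 h0] with x hx _ using hx
  filter_upwards [h] with x hx u hu j hj
  have := hx _ j hj
  rw [Submodule.inner_starProjection_left_eq_right, Submodule.starProjection_apply,
    hu.projection_eq.1] at this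
  exact this

end Moreau

/-! ### Reduction to identity covariance. -/

section Whitening

open Module
open scoped RealInnerProductSpace ENNReal MatrixOrder

/-- The square root of `Ω` as an isometry from the Euclidean inner product to `⟨·,·⟩_Ω`. -/
lemma exists_whitening {n : ℕ} {Ω : Matrix (Fin n) (Fin n) ℝ} (hΩ : Ω.PosDef) :
    ∃ R : EuclideanSpace ℝ (Fin n) ≃L[ℝ] EuclideanSpace ℝ (Fin n),
      (∀ x y, innerΩ Ω (R x) (R y) = ⟪x, y⟫) ∧
      ∀ μ, multivariateGaussian μ Ω
        = (stdGaussian (EuclideanSpace ℝ (Fin n))).map fun x => μ + R x := by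
  have hnn : 0 ≤ Ω := hΩ.posSemidef.nonneg
  set S := CFC.sqrt Ω with hS
  have hSS : S * S = Ω := CFC.sqrt_mul_sqrt_self Ω hnn
  have hSu : IsUnit S.det := (Matrix.isUnit_iff_isUnit_det S).1
    ((CFC.isUnit_sqrt_iff Ω hnn).2 hΩ.isUnit)
  have hST : Sᵀ = S := by
    have := (CFC.sqrt_nonneg Ω).isSelfAdjoint.star_eq
    rwa [Matrix.star_eq_conjTranspose, Matrix.conjTranspose_eq_transpose_of_trivial] at this
  refine ⟨ContinuousLinearEquiv.equivOfInverse (Matrix.toEuclideanCLM (𝕜 := ℝ) S)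
    (Matrix.toEuclideanCLM (𝕜 := ℝ) S⁻¹) (fun x => ?_) (fun x => ?_), fun x y => ?_, fun μ => rfl⟩
  · rw [← mul_apply_eq_comp, ← map_mul, Matrix.nonsing_inv_mul _ hSu, map_one]
    rfl
  · rw [← mul_apply_eq_comp, ← map_mul, Matrix.mul_nonsing_inv _ hSu, map_one]
    rfl
  · have hmul : S * (Ω⁻¹ * S) = 1 := by
      rw [← hSS, Matrix.mul_inv_rev, Matrix.mul_assoc, Matrix.nonsing_inv_mul _ hSu,
        Matrix.mul_one, Matrix.mul_nonsing_inv _ hSu]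
    have h1 : x.ofLp ⬝ᵥ y.ofLp = ⟪x, y⟫ := by
      rw [EuclideanSpace.inner_eq_star_dotProduct, star_trivial, dotProduct_comm]
    rw [innerΩ, ContinuousLinearEquiv.equivOfInverse_apply,
      ContinuousLinearEquiv.equivOfInverse_apply, Matrix.ofLp_toEuclideanCLM,
      Matrix.ofLp_toEuclideanCLM, Matrix.mulVec_mulVec, ← Matrix.vecMul_transpose, hST,
      ← Matrix.dotProduct_mulVec, Matrix.mulVec_mulVec, hmul, Matrix.one_mulVec, h1]

variable {n : ℕ} {Ω : Matrix (Fin n) (Fin n) ℝ}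
  {R : EuclideanSpace ℝ (Fin n) ≃L[ℝ] EuclideanSpace ℝ (Fin n)}

lemma normΩ_whitening (hR : ∀ x y, innerΩ Ω (R x) (R y) = ⟪x, y⟫) (x : EuclideanSpace ℝ (Fin n)) :
    normΩ Ω (R x) = ‖x‖ := by
  rw [normΩ, hR, real_inner_self_eq_norm_sq, Real.sqrt_sq (norm_nonneg _)]

/-- The strengthened inequality makes `R u` the only nearest point, which pins down the choice made
by `Classical.epsilon`. -/
lemma projΩ_eq_whitening (hR : ∀ x y, innerΩ Ω (R x) (R y) = ⟪x, y⟫)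
    {C : Set (EuclideanSpace ℝ (Fin n))} {x u : EuclideanSpace ℝ (Fin n)} (hu : R u ∈ C)
    (h : ∀ z, R z ∈ C → ‖x - u‖ ^ 2 + ‖u - z‖ ^ 2 ≤ ‖x - z‖ ^ 2) :
    projΩ Ω C (R x) = R u := by
  have hsurj : ∀ z, R (R.symm z) = z := R.apply_symm_apply
  have hex : IsProjΩ Ω C (R x) (R u) := by
    refine ⟨hu, fun z hz => ?_⟩
    rw [← hsurj z] at hz ⊢
    rw [← map_sub, ← map_sub, normΩ_whitening hR, normΩ_whitening hR]
    refine (sq_le_sq₀ (norm_nonneg _) (norm_nonneg _)).1 ?_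
    linarith [h _ hz, sq_nonneg ‖u - R.symm z‖]
  obtain ⟨hmem, hle⟩ := Classical.epsilon_spec (p := IsProjΩ Ω C (R x)) ⟨R u, hex⟩
  change projΩ Ω C (R x) ∈ C at hmem
  change ∀ z ∈ C, normΩ Ω (R x - projΩ Ω C (R x)) ≤ normΩ Ω (R x - z) at hle
  rw [← hsurj (projΩ Ω C (R x))] at hmem hle ⊢
  have h1 := hle _ hu
  rw [← map_sub, ← map_sub, normΩ_whitening hR, normΩ_whitening hR] at h1
  have h2 := h _ hmem
  have h3 : ‖u - R.symm (projΩ Ω C (R x))‖ ^ 2 ≤ 0 := by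
    have := pow_le_pow_left₀ (norm_nonneg _) h1 2
    linarith
  have h4 := norm_eq_zero.1 (pow_eq_zero_iff two_ne_zero |>.1 (le_antisymm h3 (sq_nonneg _)))
  rw [← sub_eq_zero.1 h4]

end Whitening

/-! ### The cones of the theorem and the two critical values. -/

section Contrast

open Module
open scoped RealInnerProductSpace ENNReal

variable {K : ℕ} {B₂ : Matrix (Fin K) (Fin (K - 1)) ℝ}

/-- The kernel of `B₂'` is spanned by the vector of ones. -/
lemma IsContrastBasis.eq_zero_of_mulVec_eq_zero (hB₂ : IsContrastBasis B₂) {l : Fin K → ℝ}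
    (hl : B₂ᵀ *ᵥ l = 0) {i : Fin K} (hi : l i = 0) : l = 0 := by
  have hsurj : Function.Surjective B₂ᵀ.mulVecLin := fun x =>
    ⟨B₂ *ᵥ x, by rw [Matrix.mulVecLin_apply, Matrix.mulVec_mulVec, hB₂.1, Matrix.one_mulVec]⟩
  have hdim := B₂ᵀ.mulVecLin.finrank_range_add_finrank_ker
  rw [LinearMap.range_eq_top.2 hsurj, finrank_top, finrank_fin_fun, finrank_fin_fun] at hdim
  have hK : 0 < K := i.pos
  have hker : finrank ℝ (LinearMap.ker B₂ᵀ.mulVecLin) = 1 := by omega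
  have hone : (1 : Fin K → ℝ) ∈ LinearMap.ker B₂ᵀ.mulVecLin := by
    ext k
    rw [Matrix.mulVecLin_apply]
    simp only [Matrix.mulVec, dotProduct, Matrix.transpose_apply, Pi.one_apply, mul_one]
    exact hB₂.2 k
  obtain ⟨c, hc⟩ := (finrank_eq_one_iff_of_nonzero' (⟨1, hone⟩ : LinearMap.ker B₂ᵀ.mulVecLin)
    fun h => one_ne_zero (congrFun (congrArg Subtype.val h) i)).1 hker ⟨l, hl⟩
  have hc' : c • (1 : Fin K → ℝ) = l := congrArg Subtype.val hc
  have : c = 0 := by rw [← hi, ← hc']; simp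
  rw [← hc', this, zero_smul]

/-- The generators of the cones `Λ(w)`. -/
def generator (B₂ : Matrix (Fin K) (Fin (K - 1)) ℝ) (j : Fin K) : EuclideanSpace ℝ (Fin (K - 1)) :=
  WithLp.toLp 2 (B₂ j)

lemma sum_smul_generator (l : Fin K → ℝ) :
    (∑ j, l j • generator B₂ j).ofLp = B₂ᵀ *ᵥ l := by
  ext k
  simp [generator, Matrix.mulVec, dotProduct, mul_comm]

/-- Extended by zero, a vanishing combination lies in the kernel of `B₂'`, so it is constant; an
index outside `A` makes the constant zero. -/
lemma IsContrastBasis.linearIndependent (hB₂ : IsContrastBasis B₂) {A : Finset (Fin K)}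
    (hA : A ≠ Finset.univ) : LinearIndependent ℝ fun j : A => generator B₂ j := by
  obtain ⟨i, hi⟩ : ∃ i, i ∉ A := by simpa [Finset.eq_univ_iff_forall] using hA
  rw [Fintype.linearIndependent_iff]
  intro g hg j
  let l : Fin K → ℝ := fun j => if h : j ∈ A then g ⟨j, h⟩ else 0
  have hl : B₂ᵀ *ᵥ l = 0 := by
    rw [← sum_smul_generator, ← WithLp.ofLp_zero 2, ← hg, Finset.sum_coe_sort_eq_attach,
      ← Finset.sum_subset (Finset.subset_univ A) (fun j _ hj => by simp [l, hj]),
      ← Finset.sum_attach A]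
    congr 1
    exact Finset.sum_congr rfl fun j _ => by simp [l]
  have := congrFun (hB₂.eq_zero_of_mulVec_eq_zero hl (i := i) (by simp [l, hi])) j
  simpa [l] using this

open scoped Classical in
/-- The indices of the generators of `Λ(w)`. -/
def vanishing (w : Fin K → ℝ) : Finset (Fin K) :=
  {j | w j = 0}

lemma mem_vanishing {w : Fin K → ℝ} {j : Fin K} : j ∈ vanishing w ↔ w j = 0 := by
  simp [vanishing]

lemma vanishing_ne_univ {w : Fin K → ℝ} (hw : w ∈ stdSimplex ℝ (Fin K)) :
    vanishing w ≠ Finset.univ := by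
  intro h
  have h0 : ∀ j, w j = 0 := fun j => mem_vanishing.1 (h ▸ Finset.mem_univ j)
  have := hw.2
  simp [h0] at this

/-- Nonnegativity of `w` and `l` turns `w' l = 0` into `l j = 0` wherever `w j ≠ 0`. -/
lemma coneΛ_eq_posCone {w : Fin K → ℝ} (hw : w ∈ stdSimplex ℝ (Fin K)) :
    coneΛ B₂ w = posCone (generator B₂) (vanishing w) := by
  ext x
  constructor
  · rintro ⟨l, hl, hwl, hx⟩
    refine ⟨l, fun j _ => hl j, ?_⟩
    have h0 := (Finset.sum_eq_zero_iff_of_nonneg fun j _ => mul_nonneg (hw.1 j) (hl j)).1 hwl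
    rw [Finset.sum_subset (Finset.subset_univ (vanishing w))]
    · exact WithLp.ofLp_injective 2 (by rw [hx, sum_smul_generator])
    · intro j _ hj
      rw [(mul_eq_zero.1 (h0 j (Finset.mem_univ j))).resolve_left (mt mem_vanishing.2 hj),
        zero_smul]
  · rintro ⟨l, hl, rfl⟩
    refine ⟨fun j => if j ∈ vanishing w then l j else 0, fun j => ?_, ?_, ?_⟩
    · by_cases hj : j ∈ vanishing w
      · simpa [hj] using hl j hj
      · simp [hj]
    · refine Finset.sum_eq_zero fun j _ => ?_
      by_cases hj : j ∈ vanishing w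
      · rw [mem_vanishing.1 hj, zero_mul]
      · simp [hj]
    · rw [← sum_smul_generator]
      simp [Finset.sum_ite_mem]

variable {Ω : Matrix (Fin (K - 1)) (Fin (K - 1)) ℝ}
  {R : EuclideanSpace ℝ (Fin (K - 1)) ≃L[ℝ] EuclideanSpace ℝ (Fin (K - 1))}

/-- The normals of the cones `Λ°(w)`. -/
def normalVector (B₂ : Matrix (Fin K) (Fin (K - 1)) ℝ)
    (Ω : Matrix (Fin (K - 1)) (Fin (K - 1)) ℝ) (j : Fin K) : EuclideanSpace ℝ (Fin (K - 1)) :=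
  WithLp.toLp 2 ((B₂ * Ω⁻¹) j)

lemma inner_normalVector (j : Fin K) (x : EuclideanSpace ℝ (Fin (K - 1))) :
    ⟪normalVector B₂ Ω j, x⟫ = ((B₂ * Ω⁻¹) *ᵥ x.ofLp) j := by
  rw [normalVector, EuclideanSpace.inner_eq_star_dotProduct, star_trivial, dotProduct_comm]
  rfl

lemma inner_normalVector_whitening (hR : ∀ x y, innerΩ Ω (R x) (R y) = ⟪x, y⟫) (j : Fin K)
    (x : EuclideanSpace ℝ (Fin (K - 1))) :
    ⟪normalVector B₂ Ω j, R x⟫ = ⟪R.symm (generator B₂ j), x⟫ := by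
  rw [← hR (R.symm _), R.apply_symm_apply, inner_normalVector, innerΩ, ← Matrix.mulVec_mulVec]
  rfl

lemma coneΛ_whitening {w : Fin K → ℝ} (hw : w ∈ stdSimplex ℝ (Fin K))
    (x : EuclideanSpace ℝ (Fin (K - 1))) :
    R x ∈ coneΛ B₂ w ↔ x ∈ posCone (fun j => R.symm (generator B₂ j)) (vanishing w) := by
  rw [coneΛ_eq_posCone hw]
  refine exists_congr fun l => and_congr_right fun _ => ?_
  rw [← R.eq_symm_apply, map_sum]
  simp

lemma negDual_normalVector_whitening (hR : ∀ x y, innerΩ Ω (R x) (R y) = ⟪x, y⟫)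
    (J : Finset (Fin K)) (x : EuclideanSpace ℝ (Fin (K - 1))) :
    R x ∈ negDual (normalVector B₂ Ω) J ↔ x ∈ negDual (fun j => R.symm (generator B₂ j)) J := by
  simp only [negDual, Set.mem_ofPred_eq, inner_normalVector_whitening hR]

lemma polarΩ_coneΛ (hR : ∀ x y, innerΩ Ω (R x) (R y) = ⟪x, y⟫) {w : Fin K → ℝ}
    (hw : w ∈ stdSimplex ℝ (Fin K)) :
    polarΩ Ω (coneΛ B₂ w) = negDual (normalVector B₂ Ω) (vanishing w) := by
  ext x
  obtain ⟨x, rfl⟩ := R.surjective x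
  rw [negDual_normalVector_whitening hR]
  constructor
  · intro h j hj
    have := h (R (R.symm (generator B₂ j))) ((coneΛ_whitening hw _).2
      (mem_posCone_of_mem (b := fun j => R.symm (generator B₂ j)) hj))
    rwa [hR, real_inner_comm] at this
  · intro h v hv
    obtain ⟨v, rfl⟩ := R.surjective v
    rw [hR]
    exact inner_nonpos_of_mem h ((coneΛ_whitening hw _).1 hv)

lemma active_whitening (hR : ∀ x y, innerΩ Ω (R x) (R y) = ⟪x, y⟫)
    (J : Finset (Fin K)) (x : EuclideanSpace ℝ (Fin (K - 1))) :
    active (normalVector B₂ Ω) J (R x) = active (fun j => R.symm (generator B₂ j)) J x := by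
  ext j
  simp only [mem_active, inner_normalVector_whitening hR]

lemma finrank_orthSpace_whitening (hR : ∀ x y, innerΩ Ω (R x) (R y) = ⟪x, y⟫)
    (A : Finset (Fin K)) :
    finrank ℝ (orthSpace (normalVector B₂ Ω) A)
      = finrank ℝ (orthSpace (fun j => R.symm (generator B₂ j)) A) := by
  have heq : orthSpace (normalVector B₂ Ω) A = Submodule.map R.toLinearEquiv.toLinearMap
      (orthSpace (fun j => R.symm (generator B₂ j)) A) := by
    ext x
    obtain ⟨x, rfl⟩ := R.surjective x
    have : R x ∈ Submodule.map R.toLinearEquiv.toLinearMap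
        (orthSpace (fun j => R.symm (generator B₂ j)) A) ↔
        x ∈ orthSpace (fun j => R.symm (generator B₂ j)) A :=
      ⟨fun ⟨y, hy, h⟩ => R.injective h ▸ hy, fun h => ⟨x, h, rfl⟩⟩
    rw [this]
    simp only [mem_orthSpace, inner_normalVector_whitening hR]
  rw [heq]
  exact R.toLinearEquiv.finrank_map_eq _

lemma IsContrastBasis.linearIndependent_whitening (hB₂ : IsContrastBasis B₂)
    {A : Finset (Fin K)} (hA : A ≠ Finset.univ) :
    LinearIndependent ℝ fun j : A => R.symm (generator B₂ j) := by
  have h := (hB₂.linearIndependent hA).map' R.symm.toLinearEquiv.toLinearMap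
    R.symm.toLinearEquiv.ker
  exact h

variable {w : Fin K → ℝ} {x u : EuclideanSpace ℝ (Fin (K - 1))}

lemma projΩ_polar_whitening (hR : ∀ x y, innerΩ Ω (R x) (R y) = ⟪x, y⟫)
    (hw : w ∈ stdSimplex ℝ (Fin K))
    (h : IsMoreau (fun j => R.symm (generator B₂ j)) (vanishing w) x u) :
    projΩ Ω (polarΩ Ω (coneΛ B₂ w)) (R x) = R u := by
  have hmem : ∀ z, R z ∈ polarΩ Ω (coneΛ B₂ w) ↔
      z ∈ negDual (fun j => R.symm (generator B₂ j)) (vanishing w) := fun z => by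
    rw [polarΩ_coneΛ hR hw, negDual_normalVector_whitening hR]
  exact projΩ_eq_whitening hR ((hmem u).2 h.mem_negDual)
    fun z hz => h.norm_sub_sq_add_le ((hmem z).1 hz)

lemma projΩ_cone_whitening (hR : ∀ x y, innerΩ Ω (R x) (R y) = ⟪x, y⟫)
    (hw : w ∈ stdSimplex ℝ (Fin K))
    (h : IsMoreau (fun j => R.symm (generator B₂ j)) (vanishing w) x u) :
    projΩ Ω (coneΛ B₂ w) (R x) = R (x - u) := by
  refine projΩ_eq_whitening hR ((coneΛ_whitening hw _).2 h.sub_mem_posCone) fun z hz => ?_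
  rw [sub_sub_cancel]
  exact h.norm_sq_add_le ((coneΛ_whitening hw _).1 hz)

/-- The critical value as a function of the active set. -/
def activeCrit (α : ℝ) (A : Finset (Fin K)) : ℝ :=
  chiSquaredQuantile (1 - α) (max (K - 1 - A.card) 1)

lemma faceCritValue_whitening (hB₂ : IsContrastBasis B₂)
    (hR : ∀ x y, innerΩ Ω (R x) (R y) = ⟪x, y⟫) (hw : w ∈ stdSimplex ℝ (Fin K)) (α : ℝ)
    (h : IsMoreau (fun j => R.symm (generator B₂ j)) (vanishing w) x u) :
    faceCritValue B₂ Ω α w (R x)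
      = activeCrit α (active (fun j => R.symm (generator B₂ j)) (vanishing w) u) := by
  have hu := (negDual_normalVector_whitening hR (vanishing w) u).2 h.mem_negDual
  have hA : active (fun j => R.symm (generator B₂ j)) (vanishing w) u ≠ Finset.univ := fun hA =>
    vanishing_ne_univ hw (Finset.eq_univ_of_forall fun j =>
      active_subset _ _ _ (hA ▸ Finset.mem_univ j))
  have hli := hB₂.linearIndependent_whitening (R := R) hA
  have hdim : finrank ℝ (Submodule.span ℝ (activeFace (normalVector B₂ Ω) (vanishing w) (R u)))
      = K - 1 - (active (fun j => R.symm (generator B₂ j)) (vanishing w) u).card := by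
    rw [span_activeFace hu, active_whitening hR, finrank_orthSpace_whitening hR,
      finrank_orthSpace (a := fun j => R.symm (generator B₂ j)) hli, finrank_euclideanSpace_fin]
  rw [faceCritValue, projΩ_polar_whitening hR hw h, polarΩ_coneΛ hR hw, activeCrit, ← hdim]
  exact finsum_face_eq hu fun F => chiSquaredQuantile (1 - α)
    (max (finrank ℝ (Submodule.span ℝ F)) 1)

lemma critValue_whitening (hB₂ : IsContrastBasis B₂)
    (hR : ∀ x y, innerΩ Ω (R x) (R y) = ⟪x, y⟫) (hw : w ∈ stdSimplex ℝ (Fin K)) (α : ℝ)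
    (h : IsMoreau (fun j => R.symm (generator B₂ j)) (vanishing w) x u)
    (hne : ∀ j, R.symm (generator B₂ j) ∉ Submodule.span ℝ ((fun j => R.symm (generator B₂ j)) ''
      active (fun j => R.symm (generator B₂ j)) (vanishing w) u) →
      ⟪R.symm (generator B₂ j), u⟫ ≠ 0) :
    critValue B₂ Ω α w (R x)
      = activeCrit α (active (fun j => R.symm (generator B₂ j)) (vanishing w) u) := by
  set A := active (fun j => R.symm (generator B₂ j)) (vanishing w) u
  have hscore : ∀ j, polarScore B₂ Ω w (R x) j = ⟪R.symm (generator B₂ j), u⟫ := fun j => by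
    rw [polarScore, projΩ_polar_whitening hR hw h, ← inner_normalVector_whitening hR,
      inner_normalVector]
  have hsub : (A : Set (Fin K)) ⊆ zeroSet (polarScore B₂ Ω w (R x)) := fun j hj => by
    rw [zeroSet, Set.mem_ofPred_eq, hscore]
    exact (mem_active.1 hj).2
  have hle : A.card ≤ (zeroSet (polarScore B₂ Ω w (R x))).ncard := by
    rw [← Set.ncard_coe_finset]
    exact Set.ncard_le_ncard hsub
  rw [critValue, activeCrit]
  congr 1
  -- Below `K - 1` active constraints, adding any index leaves a proper, hence independent, family,
  -- so `hne` excludes further zeros. Otherwise both truncated differences are `0` and both maxima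
  -- are `1`.
  by_cases hcard : A.card < K - 1
  · have hsub' : zeroSet (polarScore B₂ Ω w (R x)) ⊆ A := fun j hj => by
      by_contra hjA
      rw [zeroSet, Set.mem_ofPred_eq, hscore] at hj
      refine hne j ?_ hj
      have hins : insert j A ≠ Finset.univ := fun hins => by
        have h1 := Finset.card_insert_le j A
        rw [hins, Finset.card_univ, Fintype.card_fin] at h1
        omega
      have hli : LinearIndepOn ℝ (fun j => R.symm (generator B₂ j)) (insert j (A : Set (Fin K))) := by
        rw [← Finset.coe_insert]
        exact hB₂.linearIndependent_whitening hins
      exact hli.notMem_span_of_insert hjA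
    rw [Set.Subset.antisymm hsub' hsub, Set.ncard_coe_finset]
  · omega

end Contrast

end SimplexInference

/-! ### The theorem. -/

open SimplexInference in
theorem mainTheorem3 {S : Type*} [MeasurableSpace S] (P : Measure S) [IsProbabilityMeasure P]
    (K : ℕ) (B₂ : Matrix (Fin K) (Fin (K - 1)) ℝ) (hB₂ : SimplexInference.IsContrastBasis B₂)
    (μ : EuclideanSpace ℝ (Fin (K - 1))) (Ω : Matrix (Fin (K - 1)) (Fin (K - 1)) ℝ)
    (hΩ : Ω.PosDef)
    (Y : S → EuclideanSpace ℝ (Fin (K - 1))) (hY : HasLaw Y (multivariateGaussian μ Ω) P)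
    (α : ℝ) (hα : α ∈ Set.Ioo (0 : ℝ) 1)
    (w : Fin K → ℝ) (hw : w ∈ stdSimplex ℝ (Fin K)) :
    (μ ∈ SimplexInference.coneΛ B₂ w →
      P {s | SimplexInference.normΩ Ω
              (Y s - SimplexInference.projΩ Ω (SimplexInference.coneΛ B₂ w) (Y s)) ^ 2
            > SimplexInference.critValue B₂ Ω α w (Y s)} ≤ ENNReal.ofReal α) ∧
    (∀ᵐ s ∂P, SimplexInference.faceCritValue B₂ Ω α w (Y s)
        = SimplexInference.critValue B₂ Ω α w (Y s)) := by
  obtain ⟨R, hR, hlaw⟩ := exists_whitening hΩ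
  set b := fun j => R.symm (generator B₂ j)
  set J := vanishing w
  set m := R.symm μ
  set N := (stdGaussian (EuclideanSpace ℝ (Fin (K - 1)))).map fun x => m + x
  have hmap : P.map Y = N.map R := by
    rw [hY.map_eq, hlaw, Measure.map_map (by fun_prop) (by fun_prop)]
    congr 1
    ext1 x
    simp [m]
  have hemb : MeasurableEmbedding R := R.toHomeomorph.measurableEmbedding
  have hli : ∀ A ⊆ J, LinearIndependent ℝ fun j : A => b j := fun A hA =>
    linearIndependent_subset (hB₂.linearIndependent_whitening (vanishing_ne_univ hw)) hA
  have hmor := exists_isMoreau (hli J subset_rfl)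
  have hcrit : ∀ᵐ x ∂N, ∀ u, IsMoreau b J x u →
      critValue B₂ Ω α w (R x) = activeCrit α (active b J u) := by
    filter_upwards [gaussian_ae_inner_ne_zero b J m] with x hx u hu
    exact critValue_whitening hB₂ hR hw α hu (hx u hu)
  have hp : 1 - α ∈ Set.Ioo (0 : ℝ) 1 := ⟨by linarith [hα.2], by linarith [hα.1]⟩
  constructor
  · intro hμ
    have hm : m ∈ posCone b J := (coneΛ_whitening hw m).1 (by simpa [m] using hμ)
    -- This inequality spares a proof that the rejection event is measurable.
    refine (Measure.le_map_apply hY.aemeasurable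
      {y | normΩ Ω (y - projΩ Ω (coneΛ B₂ w) y) ^ 2 > critValue B₂ Ω α w y}).trans ?_
    rw [hmap, hemb.map_apply]
    refine (measure_mono_ae ?_).trans (gaussian_isMoreau_tail_le (hli J subset_rfl) hm
      (crit := activeCrit α) (fun A _ => chiSquaredQuantile_nonneg hp.1 _)
      (ENNReal.ofReal_le_one.2 hα.2.le) fun A hA hL => ?_)
    · filter_upwards [hcrit] with x hx hlt
      obtain ⟨u, hu⟩ := hmor x
      refine ⟨u, hu, ?_⟩
      change critValue B₂ Ω α w (R x) < normΩ Ω (R x - projΩ Ω (coneΛ B₂ w) (R x)) ^ 2 at hlt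
      rwa [hx u hu, projΩ_cone_whitening hR hw hu, ← map_sub, normΩ_whitening hR,
        sub_sub_cancel] at hlt
    · have hdim := finrank_orthSpace (hli A hA)
      rw [finrank_euclideanSpace_fin] at hdim
      have hpos := Module.finrank_pos (R := ℝ) (M := orthSpace b A)
      -- In a nontrivial `orthSpace b A` the maximum with `1` is inactive, so the degrees of freedom
      -- are its exact dimension.
      rw [activeCrit, ← hdim, max_eq_left hpos, stdGaussian_norm_sq_gt]
      simpa using chiSquared_quantile_tail_le hp (Module.finrank ℝ (orthSpace b A))
  · refine ae_of_ae_map (p := fun y => faceCritValue B₂ Ω α w y = critValue B₂ Ω α w y)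
      hY.aemeasurable ?_
    rw [hmap, hemb.ae_map_iff]
    filter_upwards [hcrit] with x hx
    obtain ⟨u, hu⟩ := hmor x
    rw [hx u hu, faceCritValue_whitening hB₂ hR hw α hu]
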